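/- Let $H$ be a finite connected graph, possibly with loops and multiple edges, with vertices $v_1,\dots,v_r$. Assign to every oriented edge $e$ of $H$ an integer voltage $\alpha(e)$ with $\alpha(e^{-1})=-\alpha(e)$, where $e^{-1}$ is the oppositely oriented edge (each loop has two orientations), and assume that the total voltages $\alpha(C^+)$ of the directed cycles $C^+$ of $H$ generate the group $\mathbb{Z}$. For a positive integer $n$ let $H_n$ be the $n$-fold cyclic covering of $H$ derived by $\alpha$: its vertices are the pairs $(v_i,k)$ with $k\in\mathbb{Z}/n\mathbb{Z}$, and each edge $e$ of $H$, oriented from $v_i$ to $v_j$, gives the $n$ edges joining $(v_i,k)$ to $(v_j,k+\alpha(e))$, $k\in\mathbb{Z}/n\mathbb{Z}$. Let $\tau(n)$ and $\tau(H)$ be the numbers of spanning trees of $H_n$ and of $H$. The voltage polynomial is the Laurent polynomial $$P(z)=\det\bigl(p_{ij}(z)\bigr)_{i,j=1}^{r},\qquad p_{ij}(z)=\delta_{ij}\,d(v_i)-\sum_{e:\,v_i\to v_j}z^{\alpha(e)},$$ where $d(v_i)$ is the degree of $v_i$ (a loop counts twice) and the sum runs over all oriented edges from $v_i$ to $v_j$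 (so a loop at $v_i$ contributes $z^{\alpha}+z^{-\alpha}$ to the sum for $i=j$). The degree of a nonzero Laurent polynomial is its highest exponent minus its lowest exponent, and its leading coefficient is the coefficient of its highest power. Then $P(z)$ has even degree, say $2s$, $P''(1)\neq 0$, and for every positive integer $n$ $$\tau(n)=\frac{2n\,\tau(H)\,\varepsilon\,a_0^{\,n}}{P''(1)}\prod_{\substack{P(z)=0\\ z\neq 1}}(z^n-1),$$ where $a_0$ is the leading coefficient of $P(z)$, $\varepsilon=(-1)^{s(n-1)}$, and the product is taken over all complex roots of $P(z)$ different from $1$, counted with multiplicity. -/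

import Mathlib

open scoped LaurentPolynomial

/-- A multigraph with vertex set `V` and edge set `E`; loops and multiple edges are allowed.
Each edge carries a reference orientation, which only serves to name its two orientations:
the graph itself is undirected. -/
structure Multigraph (V E : Type*) where
  /-- the initial vertex of an edge in its reference orientation -/
  tail : E → V
  /-- the terminal vertex of an edge in its reference orientation -/
  head : E → V

namespace Multigraph

variable {V E : Type*} (G : Multigraph V E)

/-- The initial vertex of an oriented edge. An oriented edge is a pair `(e, b)`: the edge `e` in
its reference orientation if `b = true`, in the opposite one if `b = false`. In particular each
loop gives two oriented edges. -/
def src (d : E × Bool) : V := if d.2 then G.tail d.1 else G.head d.1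

/-- The terminal vertex of an oriented edge. -/
def tgt (d : E × Bool) : V := if d.2 then G.head d.1 else G.tail d.1

/-- `G.IsWalk u p v`: the list `p` of consecutive oriented edges is a walk from `u` to `v`. -/
def IsWalk : V → List (E × Bool) → V → Prop
  | u, [], v => u = v
  | u, d :: p, v => G.src d = u ∧ IsWalk (G.tgt d) p v

/-- A directed cycle: a nonempty closed walk that repeats neither an edge nor a vertex. A loop is
a cycle of length one, and two parallel edges form a cycle of length two. -/
def IsCycle (p : List (E × Bool)) : Prop :=
  p ≠ [] ∧ (∃ v, G.IsWalk v p v) ∧ (p.map Prod.fst).Nodup ∧ (p.map G.src).Nodup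

/-- Connected (and nonempty) graphs. -/
def Connected : Prop := Nonempty V ∧ ∀ u v, ∃ p, G.IsWalk u p v

/-- A tree is a connected graph without cycles. -/
def IsTree : Prop := G.Connected ∧ ∀ p, ¬ G.IsCycle p

/-- The subgraph with all the vertices of `G` and the edges in `S`. -/
def spanningSubgraph (S : Set E) : Multigraph V S where
  tail e := G.tail e
  head e := G.head e

/-- `τ(G)`, the number of spanning trees of `G`. -/
noncomputable def numSpanningTrees : ℕ := {S : Set E | (G.spanningSubgraph S).IsTree}.ncard

/-- The voltage of an oriented edge, when `α e` is the voltage of `e` in its reference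
orientation: opposite orientations of an edge get opposite voltages. -/
def voltage (α : E → ℤ) (d : E × Bool) : ℤ := if d.2 then α d.1 else -α d.1

/-- The total voltage along a list of oriented edges. -/
def walkVoltage (α : E → ℤ) (p : List (E × Bool)) : ℤ := (p.map (voltage α)).sum

/-- The set of voltages of all the directed cycles of `G`. -/
def cycleVoltages (α : E → ℤ) : Set ℤ := {k | ∃ p, G.IsCycle p ∧ walkVoltage α p = k}

/-- The `n`-fold cyclic covering derived from the voltage assignment `α`: over each vertex `v` lie
the vertices `(v, k)` with `k` modulo `n`, and over each edge `e` from `u` to `v` lie the edges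
`(e, k)` from `(u, k)` to `(v, k + α e)`. -/
def cyclicCover (α : E → ℤ) (n : ℕ) : Multigraph (V × ZMod n) (E × ZMod n) where
  tail e := (G.tail e.1, e.2)
  head e := (G.head e.1, e.2 + (α e.1 : ZMod n))

section Voltage

variable [Fintype E] [DecidableEq V]

/-- The degree of a vertex: the number of oriented edges that start there (so a loop counts
twice). -/
def degree (v : V) : ℕ := (Finset.univ.filter fun d : E × Bool => G.src d = v).card

/-- The matrix with entries `p i j`, where `p i j` is the degree of `i` if `i = j` and `0` otherwise,
minus the sum of `z ^ voltage d` over the oriented edges `d` from `i` to `j`. -/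
noncomputable def voltageMatrix (α : E → ℤ) : Matrix V V ℤ[T;T⁻¹] := fun i j =>
  (if i = j then (G.degree i : ℤ[T;T⁻¹]) else 0) -
    ∑ d : E × Bool with G.src d = i ∧ G.tgt d = j, LaurentPolynomial.T (voltage α d)

/-- The voltage polynomial `P(z)`, a Laurent polynomial with integer coefficients. -/
noncomputable def voltagePolynomial [Fintype V] (α : E → ℤ) : ℤ[T;T⁻¹] :=
  (G.voltageMatrix α).det

end Voltage

end Multigraph

/-- The lowest exponent that occurs in a Laurent polynomial. -/
noncomputable def laurentLowExponent (f : ℤ[T;T⁻¹]) : ℤ := sInf {k : ℤ | f.coeff k ≠ 0}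

/-- The ordinary polynomial `z ^ (-m) * f(z)`, where `m` is the lowest exponent of `f`. For `f ≠ 0`
it has a nonzero constant term, and its roots are the roots of `f`, with multiplicity. -/
noncomputable def laurentNumerator (f : ℤ[T;T⁻¹]) : Polynomial ℤ :=
  LaurentPolynomial.trunc (LaurentPolynomial.T (-laurentLowExponent f) * f)

/-- The degree of a Laurent polynomial: its highest exponent minus its lowest one. -/
noncomputable def laurentDegree (f : ℤ[T;T⁻¹]) : ℕ := (laurentNumerator f).natDegree

/-- The leading coefficient of a Laurent polynomial: the coefficient of its highest power. -/
noncomputable def laurentLeadingCoeff (f : ℤ[T;T⁻¹]) : ℤ := (laurentNumerator f).leadingCoeff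

/-- The complex roots of a Laurent polynomial, with multiplicity. -/
noncomputable def laurentRoots (f : ℤ[T;T⁻¹]) : Multiset ℂ := (laurentNumerator f).aroots ℂ

/-- A Laurent polynomial as a function of a complex variable `z ≠ 0`. -/
noncomputable def laurentEval (f : ℤ[T;T⁻¹]) (z : ℂ) : ℂ := f.coeff.sum fun k c => (c : ℂ) * z ^ k

/-!
The argument evaluates one determinant over the covering in two ways.

Let `L` be the Laplacian of a graph with `N` vertices and `J` the all-ones matrix. The matrix-tree
theorem in the form `det (L + c • J) = c * N ^ 2 * τ` (`Multigraph.det_twistedLaplacian_one_add_smul`)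
comes from the Cauchy–Binet formula applied to the incidence matrix with one extra column for a
root: a square set of columns is independent exactly when it consists of the root and a spanning
tree (`Multigraph.det_rootedIncidence_ne_zero_iff`), and then its determinant is `±1`.

The Fourier transform along the fibres of the covering `H_n` turns `L + J` into diagonal blocks:
the voltage matrix at each `n`-th root of unity, with `n • J` added at the root `1`. Comparing
determinants gives `n * τ(n) = τ(H) * ∏ P(ζ)`, the product over the `n`-th roots of unity
`ζ ≠ 1` (`Multigraph.numSpanningTrees_cyclicCover`).

Since reversing the edges transposes the voltage matrix, `P(1/z) = P(z)`, so that
`P(z) = z ^ (-s) * (z - 1) ^ 2 * R(z)` with `R` of even degree `2 * s - 2`, and `P''(1) = 2 * R(1)`.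
The one analytic point is `R(1) ≠ 0` (`Multigraph.not_isLittleO_laurentEval`). On the unit circle the
Hermitian form of the voltage matrix is `∑ e, |x(tail e) - z ^ α(e) * x(head e)| ^ 2`. If
`P(exp (i θ))` were `o(θ ^ 2)`, then along a column `x(θ)` of the adjugate matrix each of these
differences would be `o(θ)`; as `x(0)` is the nonzero constant `τ(H)`, the derivative `x'(0)` would
be, up to a factor, a potential whose differences are the voltages. All cycles would then have
voltage zero, although the cycle voltages generate `ℤ`.

What remains is to expand `∏ P(ζ)` over the roots of `R` (`prod_eval_stdAddChar`), using
`∏ (x - ζ) = 1 + x + ⋯ + x ^ (n - 1)`.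
-/

namespace Multigraph

/-! ### Walks, paths and bridges -/

section Walks

variable {V E : Type*} (G : Multigraph V E)

theorem IsWalk.append {G : Multigraph V E} {u v w : V} {p q : List (E × Bool)}
    (hp : G.IsWalk u p v) (hq : G.IsWalk v q w) : G.IsWalk u (p ++ q) w := by
  induction p generalizing u with
  | nil => obtain rfl : u = v := hp; exact hq
  | cons d p ih => exact ⟨hp.1, ih hp.2⟩

theorem IsWalk.of_append {G : Multigraph V E} {u v : V} {p q : List (E × Bool)}
    (h : G.IsWalk u (p ++ q) v) : ∃ w, G.IsWalk u p w ∧ G.IsWalk w q v := by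
  induction p generalizing u with
  | nil => exact ⟨u, rfl, h⟩
  | cons d p ih =>
    obtain ⟨w, h₁, h₂⟩ := ih h.2
    exact ⟨w, ⟨h.1, h₁⟩, h₂⟩

/-- The increments of a potential along a walk telescope. -/
theorem IsWalk.sum_sub {G : Multigraph V E} {A : Type*} [AddCommGroup A] (c : V → A)
    {u v : V} {p : List (E × Bool)} (h : G.IsWalk u p v) :
    (p.map fun d => c (G.tgt d) - c (G.src d)).sum = c v - c u := by
  induction p generalizing u with
  | nil => obtain rfl : u = v := h; simp
  | cons d p ih =>
    rw [List.map_cons, List.sum_cons, ih h.2, h.1]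
    abel

theorem IsWalk.tgt_mem {G : Multigraph V E} {u v : V} {p : List (E × Bool)}
    (h : G.IsWalk u p v) {d : E × Bool} (hd : d ∈ p) : G.tgt d ∈ p.map G.src ∨ G.tgt d = v := by
  induction p generalizing u with
  | nil => simp at hd
  | cons a p ih =>
    rcases List.mem_cons.1 hd with rfl | hd
    · cases p with
      | nil => exact Or.inr h.2
      | cons b p => exact Or.inl (by simp [h.2.1])
    · rcases ih h.2 hd with h' | h'
      · exact Or.inl (List.mem_cons_of_mem _ h')
      · exact Or.inr h'

/-- A walk between `u` and `v` can be shortened to a path, a walk that visits every vertex at most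
once. -/
theorem IsWalk.exists_path {G : Multigraph V E} {u v : V} {p : List (E × Bool)}
    (h : G.IsWalk u p v) :
    ∃ q, G.IsWalk u q v ∧ (q.map G.src).Nodup ∧ v ∉ q.map G.src ∧ q ⊆ p := by
  induction p generalizing u with
  | nil => exact ⟨[], h, by simp, by simp, by simp⟩
  | cons d p ih =>
    obtain ⟨q, hq, hn, hv, hs⟩ := ih h.2
    by_cases hu : u ∈ q.map G.src
    · obtain ⟨d', hd', rfl⟩ := List.mem_map.1 hu
      obtain ⟨q₁, q₂, rfl⟩ := List.append_of_mem hd'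
      obtain ⟨w, -, h₂⟩ := hq.of_append
      refine ⟨d' :: q₂, ⟨rfl, h₂.2⟩, ?_, ?_, ?_⟩
      · rw [List.map_append] at hn
        exact (List.nodup_append.1 hn).2.1
      · intro hm
        exact hv (by rw [List.map_append]; exact List.mem_append_right _ hm)
      · intro x hx
        exact List.mem_cons_of_mem _ (hs (List.mem_append_right _ hx))
    · by_cases huv : u = v
      · exact ⟨[], huv, by simp, by simp, by simp⟩
      · refine ⟨d :: q, ⟨h.1, hq⟩, ?_, ?_, ?_⟩
        · rw [List.map_cons, List.nodup_cons, h.1]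
          exact ⟨hu, hn⟩
        · rw [List.map_cons, List.mem_cons, h.1, not_or]
          exact ⟨fun hh => huv hh.symm, hv⟩
        · exact List.cons_subset_cons _ hs

theorem eq_or_tgt_eq_src {d d' : E × Bool} (h : d'.1 = d.1) : d' = d ∨ G.tgt d' = G.src d := by
  obtain ⟨e, b⟩ := d
  obtain ⟨e', b'⟩ := d'
  obtain rfl : e' = e := h
  cases b <;> cases b' <;> simp [src, tgt]

/-- A path does not repeat an edge: traversing an edge again, in either direction, would lead
through a vertex that was already visited. -/
theorem IsWalk.nodup_edges {G : Multigraph V E} {u v : V} {p : List (E × Bool)}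
    (h : G.IsWalk u p v) (hn : (p.map G.src).Nodup) (hv : v ∉ p.map G.src) :
    (p.map Prod.fst).Nodup := by
  induction p generalizing u with
  | nil => simp
  | cons d p ih =>
    rw [List.map_cons, List.nodup_cons] at hn ⊢
    rw [List.map_cons, List.mem_cons, not_or] at hv
    refine ⟨fun hd => ?_, ih h.2 hn.2 hv.2⟩
    obtain ⟨d', hd', he⟩ := List.mem_map.1 hd
    rcases G.eq_or_tgt_eq_src he with rfl | ht
    · exact hn.1 (List.mem_map_of_mem hd')
    · rcases h.2.tgt_mem hd' with h' | h'
      · exact hn.1 (ht ▸ h')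
      · exact hv.1 (h'.symm.trans ht)

/-- In a graph without cycles every edge is a bridge: its end vertices are not joined by a walk
that avoids it. -/
theorem not_isWalk_of_acyclic (h : ∀ p, ¬ G.IsCycle p) (e : E) (p : List (E × Bool))
    (hp : ∀ d ∈ p, d.1 ≠ e) : ¬ G.IsWalk (G.tail e) p (G.head e) := by
  intro hw
  obtain ⟨q, hq, hn, hv, hs⟩ := hw.exists_path
  refine h ((e, false) :: q) ⟨by simp, ⟨G.head e, ?_⟩, ?_, ?_⟩
  · exact ⟨by simp [src], by simpa [tgt] using hq⟩
  · rw [List.map_cons, List.nodup_cons]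
    refine ⟨fun hm => ?_, hq.nodup_edges hn hv⟩
    obtain ⟨d, hd, hde⟩ := List.mem_map.1 hm
    exact hp d (hs hd) hde
  · rw [List.map_cons, List.nodup_cons]
    exact ⟨by simpa [src] using hv, hn⟩

end Walks

end Multigraph

/-! ### Determinant identities -/

open Matrix in
/-- The Cauchy–Binet formula, as a sum over all maps `f` instead of subsets of `K`: non-injective
maps contribute zero, and every subset of the right size is the range of `(card V)!` maps. -/
theorem Matrix.factorial_mul_det_mul {V K R : Type*} [Fintype V] [DecidableEq V] [Fintype K]
    [CommRing R] (A : Matrix V K R) (B : Matrix K V R) :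
    ((Fintype.card V).factorial : R) * (A * B).det =
      ∑ f : V → K, (A.submatrix id f).det * (B.submatrix f id).det := by
  classical
  have h₁ : (A * B).det = ∑ f : V → K, (∏ v, A v (f v)) * (B.submatrix f id).det := by
    have hAB : A * B = fun v => ∑ k, A v k • B k := by
      ext v w
      simp [Matrix.mul_apply, Finset.sum_apply]
    change Matrix.detRowAlternating.toMultilinearMap (A * B) = _
    rw [hAB, MultilinearMap.map_sum]
    refine Finset.sum_congr rfl fun f _ => ?_
    rw [MultilinearMap.map_smul_univ]
    rfl
  have h₂ : ∀ f : V → K, (A.submatrix id f).det * (B.submatrix f id).det =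
      ∑ σ : Equiv.Perm V, (∏ v, A v (f (σ v))) * (B.submatrix (f ∘ σ) id).det := by
    intro f
    rw [← Matrix.det_transpose (A.submatrix id f), Matrix.det_apply', Finset.sum_mul]
    refine Finset.sum_congr rfl fun σ _ => ?_
    have : B.submatrix (f ∘ σ) id = (B.submatrix f id).submatrix σ id := rfl
    rw [this, Matrix.det_permute]
    simp only [Matrix.transpose_apply, Matrix.submatrix_apply, id]
    ring
  simp_rw [h₂]
  rw [Finset.sum_comm]
  have h₃ : ∀ σ : Equiv.Perm V,
      ∑ f : V → K, (∏ v, A v (f (σ v))) * (B.submatrix (f ∘ σ) id).det = (A * B).det := by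
    intro σ
    rw [h₁]
    exact Fintype.sum_equiv (Equiv.arrowCongr σ.symm (Equiv.refl K)) _ _ fun f => rfl
  simp [h₃, Fintype.card_perm]

namespace Multigraph

/-! ### The incidence matrix and trees -/

section Incidence

variable {V E : Type*} [DecidableEq V] (G : Multigraph V E)

/-- The incidence matrix of `G` over `ℤ`, with one more column `none` that holds the basis vector
of the root `j`. The column of an edge is the difference of the basis vectors of its ends. -/
def rootedIncidence (j : V) : Matrix V (Option E) ℤ := fun v o =>
  o.elim (Pi.single j 1 : V → ℤ)
    (fun e => Pi.single (G.head e) 1 - Pi.single (G.tail e) 1) v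

theorem rootedIncidence_submatrix (j : V) (S : Set E) :
    (G.rootedIncidence j).submatrix id (Option.map ((↑) : S → E)) =
      (G.spanningSubgraph S).rootedIncidence j := by
  ext v o
  cases o <;> rfl

variable [Fintype V]

theorem vecMul_rootedIncidence_none (j : V) (y : V → ℤ) :
    Matrix.vecMul y (G.rootedIncidence j) none = y j := by
  simp [Matrix.vecMul, rootedIncidence, dotProduct, Pi.single_apply]

theorem vecMul_rootedIncidence_some (j : V) (y : V → ℤ) (e : E) :
    Matrix.vecMul y (G.rootedIncidence j) (some e) = y (G.head e) - y (G.tail e) := by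
  simp [Matrix.vecMul, rootedIncidence, dotProduct, mul_sub, Finset.sum_sub_distrib,
    Pi.single_apply]

/-- The indicator function of the vertices that are not reachable from the root is orthogonal to
all the columns. -/
theorem det_rootedIncidence_of_not_connected (h : ¬ G.Connected) (j : V) (e : V ≃ Option E) :
    ((G.rootedIncidence j).submatrix id e).det = 0 := by
  classical
  let S : V → Prop := fun v => ∃ p, G.IsWalk j p v
  have hS : ∀ e', S (G.head e') ↔ S (G.tail e') := by
    intro e'
    constructor
    · rintro ⟨p, hp⟩
      exact ⟨p ++ [(e', false)], hp.append ⟨by simp [src], by simp [IsWalk, tgt]⟩⟩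
    · rintro ⟨p, hp⟩
      exact ⟨p ++ [(e', true)], hp.append ⟨by simp [src], by simp [IsWalk, tgt]⟩⟩
  -- Walks can be reversed, so reachability from the root alone already implies connectedness.
  have hrev : ∀ (p : List (E × Bool)) (u v : V), G.IsWalk u p v → ∃ q, G.IsWalk v q u := by
    intro p
    induction p with
    | nil => intro u v (h : u = v); exact ⟨[], h.symm⟩
    | cons d p ih =>
      intro u v hw
      obtain ⟨q, hq⟩ := ih _ _ hw.2
      refine ⟨q ++ [(d.1, !d.2)], hq.append ?_⟩
      rw [← hw.1]
      obtain ⟨e, b⟩ := d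
      cases b <;> simp [IsWalk, src, tgt]
  have hex : ∃ v, ¬ S v := by
    by_contra hcon
    push Not at hcon
    refine h ⟨⟨j⟩, fun u v => ?_⟩
    obtain ⟨p, hp⟩ := hcon u
    obtain ⟨q, hq⟩ := hcon v
    obtain ⟨p', hp'⟩ := hrev _ _ _ hp
    exact ⟨_, hp'.append hq⟩
  obtain ⟨v, hv⟩ := hex
  refine Matrix.exists_vecMul_eq_zero_iff.1 ⟨fun v => if S v then 0 else 1, ?_, ?_⟩
  · intro h0
    simpa [hv] using congrFun h0 v
  · ext w
    have hz : ∀ o, Matrix.vecMul (fun v => if S v then (0 : ℤ) else 1)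
        (G.rootedIncidence j) o = 0 := by
      intro o
      cases o with
      | none =>
        rw [vecMul_rootedIncidence_none, if_pos ⟨[], rfl⟩]
      | some e' =>
        rw [vecMul_rootedIncidence_some]
        simp [hS e']
    exact hz (e w)

variable [Fintype E]

/-- Along a walk from the root to `v` the columns of the edges telescope to the basis vector at `v`
minus that of the root. -/
theorem Connected.rootedIncidence_surjective {G : Multigraph V E} (h : G.Connected) (j : V) :
    Function.Surjective (G.rootedIncidence j).mulVecLin := by
  classical
  set R := LinearMap.range (G.rootedIncidence j).mulVecLin with hR
  have hcol : ∀ o, (fun v => G.rootedIncidence j v o) ∈ R := fun o =>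
    ⟨Pi.single o 1, by ext v; simp⟩
  have hwalk : ∀ (p : List (E × Bool)) (u v : V), G.IsWalk u p v →
      (Pi.single v 1 - Pi.single u 1 : V → ℤ) ∈ R := by
    intro p
    induction p with
    | nil =>
      intro u v (h : u = v)
      simp [h]
    | cons d p ih =>
      intro u v hw
      have h₁ := ih _ _ hw.2
      have h₂ : (Pi.single (G.tgt d) 1 - Pi.single (G.src d) 1 : V → ℤ) ∈ R := by
        obtain ⟨e, b⟩ := d
        cases b
        · have := R.neg_mem (hcol (some e))
          convert! this using 1
          ext v
          simp [rootedIncidence, src, tgt]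
        · exact hcol (some e)
      rw [hw.1] at h₂
      simpa using R.add_mem h₁ h₂
  have hsingle : ∀ v, (Pi.single v 1 : V → ℤ) ∈ R := by
    intro v
    obtain ⟨p, hp⟩ := h.2 j v
    have hj : (Pi.single j 1 : V → ℤ) ∈ R := hcol none
    simpa using R.add_mem (hwalk p j v hp) hj
  intro y
  have : y = ∑ v, y v • (Pi.single v 1 : V → ℤ) := by
    ext w
    simp [Finset.sum_apply, Pi.single_apply]
  have hy : y ∈ R := by
    rw [this]
    exact R.sum_mem fun v _ => R.smul_mem _ (hsingle v)
  exact hy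

/-- A vector on the edges annihilated by the incidence matrix vanishes at every bridge: pair it
with the indicator function of one side of the bridge. -/
theorem rootedIncidence_injective_of_acyclic (h : ∀ p, ¬ G.IsCycle p) (j : V) :
    Function.Injective (G.rootedIncidence j).mulVecLin := by
  classical
  rw [← LinearMap.ker_eq_bot, LinearMap.ker_eq_bot']
  intro c hc
  have hpair : ∀ y : V → ℤ,
      y j * c none + ∑ e, (y (G.head e) - y (G.tail e)) * c (some e) = 0 := by
    intro y
    have h₀ : dotProduct (Matrix.vecMul y (G.rootedIncidence j)) c = 0 := by
      rw [← Matrix.dotProduct_mulVec, ← Matrix.mulVecLin_apply, hc, dotProduct_zero]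
    rw [dotProduct, Fintype.sum_option] at h₀
    simpa only [vecMul_rootedIncidence_none, vecMul_rootedIncidence_some] using h₀
  have hnone : c none = 0 := by simpa using hpair fun _ => 1
  ext o
  cases o with
  | none => exact hnone
  | some e =>
    -- the vertices reachable from the tail of `e` without using `e`
    let S : V → Prop := fun v => ∃ p, G.IsWalk (G.tail e) p v ∧ ∀ d ∈ p, d.1 ≠ e
    have hS : ∀ e', e' ≠ e → (S (G.head e') ↔ S (G.tail e')) := by
      intro e' he'
      constructor
      · rintro ⟨p, hp, hpe⟩
        refine ⟨p ++ [(e', false)], hp.append ⟨by simp [src], by simp [IsWalk, tgt]⟩, ?_⟩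
        intro d hd
        rcases List.mem_append.1 hd with hd | hd
        · exact hpe d hd
        · rw [List.mem_singleton.1 hd]; exact he'
      · rintro ⟨p, hp, hpe⟩
        refine ⟨p ++ [(e', true)], hp.append ⟨by simp [src], by simp [IsWalk, tgt]⟩, ?_⟩
        intro d hd
        rcases List.mem_append.1 hd with hd | hd
        · exact hpe d hd
        · rw [List.mem_singleton.1 hd]; exact he'
    have ht : S (G.tail e) := ⟨[], rfl, by simp⟩
    have hh : ¬ S (G.head e) := fun ⟨p, hp, hpe⟩ => G.not_isWalk_of_acyclic h e p hpe hp
    have := hpair fun v => if S v then 1 else 0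
    rw [hnone, mul_zero, zero_add, Finset.sum_eq_single e] at this
    · simpa [ht, hh] using this
    · intro e' _ he'
      simp [hS e' he']
    · simp

theorem IsTree.card_eq {G : Multigraph V E} (h : G.IsTree) :
    Fintype.card V = Fintype.card (Option E) := by
  obtain ⟨j⟩ := h.1.1
  exact le_antisymm (card_le_of_surjective ℤ _ (h.1.rootedIncidence_surjective j))
    (card_le_of_injective ℤ _ (G.rootedIncidence_injective_of_acyclic h.2 j))

theorem mulVecLin_submatrix_equiv {G : Multigraph V E} (j : V) (e : V ≃ Option E) (c : V → ℤ) :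
    ((G.rootedIncidence j).submatrix id e).mulVec c =
      (G.rootedIncidence j).mulVecLin (c ∘ e.symm) := by
  ext v
  simp only [Matrix.mulVecLin_apply, Matrix.mulVec, dotProduct, Matrix.submatrix_apply, id,
    Function.comp]
  exact Fintype.sum_equiv e _ _ fun w => by simp

/-- The columns of a connected graph and the root generate `ℤ ^ V`, so that a square matrix of them
is invertible over `ℤ`. -/
theorem Connected.det_sq_eq_one {G : Multigraph V E} (h : G.Connected) (j : V)
    (e : V ≃ Option E) : ((G.rootedIncidence j).submatrix id e).det ^ 2 = 1 := by
  have hsurj := h.rootedIncidence_surjective j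
  choose c hc using fun v : V => hsurj (Pi.single v 1)
  have hmul : (G.rootedIncidence j).submatrix id e *
      (Matrix.of fun v w => c w (e v) : Matrix V V ℤ) = 1 := by
    ext v w
    have := congrFun (mulVecLin_submatrix_equiv (G := G) j e (c w ∘ e)) v
    rw [show (c w ∘ e) ∘ e.symm = c w by ext; simp, hc] at this
    rw [show (1 : Matrix V V ℤ) v w = (Pi.single w 1 : V → ℤ) v by
      simp [Matrix.one_apply, Pi.single_apply], ← this]
    rfl
  have := Matrix.isUnit_det_of_right_inverse hmul
  rcases Int.isUnit_iff.1 this with h | h <;> simp [h]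

/-- The edges of a cycle, with signs, form a linear relation between the columns of the incidence
matrix. -/
theorem det_rootedIncidence_of_isCycle {p : List (E × Bool)} (h : G.IsCycle p) (j : V)
    (e : V ≃ Option E) : ((G.rootedIncidence j).submatrix id e).det = 0 := by
  classical
  obtain ⟨hne, ⟨v, hv⟩, hn, -⟩ := h
  let flow : List (E × Bool) → Option E → ℤ := fun p =>
    (p.map fun d => (Pi.single (some d.1) (if d.2 then 1 else -1) : Option E → ℤ)).sum
  have hflow : ∀ (p : List (E × Bool)) (u v : V), G.IsWalk u p v →
      (G.rootedIncidence j).mulVecLin (flow p) = Pi.single v 1 - Pi.single u 1 := by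
    intro p u v hw
    rw [← hw.sum_sub (fun v => (Pi.single v 1 : V → ℤ)), map_list_sum, List.map_map]
    congr 1
    refine List.map_congr_left fun d _ => ?_
    ext w
    obtain ⟨e, b⟩ := d
    cases b <;> simp [rootedIncidence, src, tgt]
  have hzero : ∀ (p : List (E × Bool)) (e : E), e ∉ p.map Prod.fst → flow p (some e) = 0 := by
    intro p e
    induction p with
    | nil => simp [flow]
    | cons d p ih =>
      intro he
      rw [List.map_cons, List.mem_cons, not_or] at he
      have := ih he.2
      simp only [flow, List.map_cons, List.sum_cons, Pi.add_apply] at this ⊢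
      rw [this, Pi.single_eq_of_ne (by simpa using he.1), add_zero]
  refine Matrix.exists_mulVec_eq_zero_iff.1 ⟨flow p ∘ e, ?_, ?_⟩
  · cases p with
    | nil => exact absurd rfl hne
    | cons d p =>
      rw [List.map_cons, List.nodup_cons] at hn
      intro h0
      have h1 := congrFun h0 (e.symm (some d.1))
      have h2 := hzero p d.1 hn.1
      simp only [flow] at h2
      simp only [flow, Function.comp, Equiv.apply_symm_apply, List.map_cons, List.sum_cons,
        Pi.add_apply, h2, Pi.single_eq_same, Pi.zero_apply, add_zero] at h1
      split_ifs at h1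
      all_goals omega
  · rw [mulVecLin_submatrix_equiv, show (flow p ∘ e) ∘ e.symm = flow p by ext; simp,
      hflow p v v hv, sub_self]

theorem det_rootedIncidence_ne_zero_iff (j : V) (e : V ≃ Option E) :
    ((G.rootedIncidence j).submatrix id e).det ≠ 0 ↔ G.IsTree := by
  constructor
  · intro h
    refine ⟨?_, fun p hp => h (G.det_rootedIncidence_of_isCycle hp j e)⟩
    by_contra hc
    exact h (G.det_rootedIncidence_of_not_connected hc j e)
  · intro h h0
    simpa [h0] using h.1.det_sq_eq_one j e

end Incidence

end Multigraph

open Matrix in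
theorem Matrix.det_add_smul_vecMulVec_single {V R : Type*} [Fintype V] [DecidableEq V]
    [CommRing R] (L : Matrix V V R) (j : V) (c : R) :
    (L + c • vecMulVec (Pi.single j 1) (Pi.single j 1)).det = L.det + c * L.adjugate j j := by
  have hrow : L + c • vecMulVec (Pi.single j 1) (Pi.single j 1) =
      L.updateRow j (L j + c • Pi.single j 1) := by
    ext v w
    by_cases hv : v = j
    · subst hv
      simp [vecMulVec_apply]
    · simp [vecMulVec_apply, hv]
  rw [hrow, det_updateRow_add, updateRow_eq_self, det_updateRow_smul, adjugate_apply]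

open Matrix in
/-- If the rows and the columns of `L` sum to zero, adding a multiple of the all-ones matrix has
the same effect on the determinant as adding a multiple of one diagonal matrix unit, up to the
square of the size. -/
theorem Matrix.det_add_smul_vecMulVec_one {V R : Type*} [Fintype V] [DecidableEq V] [CommRing R]
    (L : Matrix V V R) (hl : (1 : V → R) ᵥ* L = 0) (hr : L *ᵥ (1 : V → R) = 0)
    (j : V) (c : R) :
    (L + c • vecMulVec (1 : V → R) 1).det = (Fintype.card V : R) ^ 2 * (c * L.adjugate j j) := by
  -- `P` fixes `L` on both sides and maps the basis vector at `j` to the all-ones vector.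
  set u : V → R := 1 - Pi.single j 1 with hu
  set P : Matrix V V R := 1 + vecMulVec u 1 with hP
  have hPL : P * L = L := by
    rw [hP, add_mul, one_mul, vecMulVec_mul, hl, vecMulVec_zero, add_zero]
  have hPt : Pᵀ = 1 + vecMulVec 1 u := by
    rw [hP, transpose_add, transpose_one, transpose_vecMulVec]
  have hLP : L * Pᵀ = L := by
    rw [hPt, mul_add, mul_one, mul_vecMulVec, hr, zero_vecMulVec, add_zero]
  have hPe : P *ᵥ Pi.single j 1 = 1 := by
    rw [hP, add_mulVec, one_mulVec, vecMulVec_mulVec]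
    ext v
    simp [hu]
  have hdet : P.det = (Fintype.card V : R) := by
    rw [hP, vecMulVec_eq Unit, det_one_add_replicateCol_mul_replicateRow, hu]
    simp [dotProduct]
  have hmul : L + c • vecMulVec (1 : V → R) 1 =
      P * (L + c • vecMulVec (Pi.single j 1) (Pi.single j 1)) * Pᵀ := by
    rw [mul_add, add_mul, hPL, hLP, mul_smul_comm, smul_mul_assoc, mul_vecMulVec, hPe,
      vecMulVec_mul, vecMul_transpose, hPe]
  have hL : L.det = 0 := by
    have h := congrArg (fun x => x j) (congrArg (fun M => M *ᵥ (1 : V → R)) (adjugate_mul L))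
    simpa [← mulVec_mulVec, hr, smul_mulVec] using h.symm
  rw [hmul, det_mul, det_mul, det_transpose, hdet, det_add_smul_vecMulVec_single, hL]
  ring

theorem Option.some_mem_range_map_val {E : Type*} (S : Set E) (a : E) :
    some a ∈ Set.range (Option.map ((↑) : S → E)) ↔ a ∈ S := by
  constructor
  · rintro ⟨o, ho⟩
    obtain ⟨b, -, rfl⟩ := Option.map_eq_some_iff.1 ho
    exact b.2
  · exact fun h => ⟨some ⟨a, h⟩, rfl⟩

theorem Function.Injective.exists_equiv_of_range_eq {α β γ : Type*} {f : α → γ} {g : β → γ}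
    (hf : Function.Injective f) (hg : Function.Injective g) (h : Set.range f = Set.range g) :
    ∃ e : α ≃ β, f = g ∘ e := by
  refine ⟨(Equiv.ofInjective f hf).trans ((Equiv.setCongr h).trans
    (Equiv.ofInjective g hg).symm), ?_⟩
  ext a
  simp [Equiv.apply_ofInjective_symm]

namespace Multigraph

/-! ### Twisted Laplacians and the matrix-tree theorem -/

section Laplacian

variable {V E : Type*} [DecidableEq V] [Fintype E] (G : Multigraph V E)

/-- The Laplacian matrix of `G` in which every oriented edge `d` has the weight `φ d`. The ordinary
Laplacian is the case `φ = 1`, and the voltage matrix is the case of the powers `T (voltage α d)`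
of the variable. -/
def twistedLaplacian {R : Type*} [CommRing R] (φ : E × Bool → R) : Matrix V V R := fun i j =>
  (if i = j then (G.degree i : R) else 0) - ∑ d : E × Bool with G.src d = i ∧ G.tgt d = j, φ d

variable {R : Type*} [CommRing R]

theorem map_twistedLaplacian {S : Type*} [CommRing S] (f : R →+* S) (φ : E × Bool → R) :
    (G.twistedLaplacian φ).map f = G.twistedLaplacian (f ∘ φ) := by
  ext i j
  simp only [Matrix.map_apply, twistedLaplacian, map_sub, map_sum, Function.comp]
  split_ifs <;> simp

theorem transpose_twistedLaplacian (φ : E × Bool → R) :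
    (G.twistedLaplacian φ).transpose = G.twistedLaplacian fun d => φ (d.1, !d.2) := by
  ext i j
  simp only [Matrix.transpose_apply, twistedLaplacian]
  congr 1
  · by_cases h : i = j
    · simp [h]
    · simp [h, Ne.symm h]
  · rw [Finset.sum_filter, Finset.sum_filter]
    refine Fintype.sum_equiv ((Equiv.refl E).prodCongr Equiv.boolNot) _ _ fun d => ?_
    obtain ⟨e, b⟩ := d
    cases b <;> simp [src, tgt, and_comm]

theorem twistedLaplacian_mulVec [Fintype V] (φ : E × Bool → R) (x : V → R) (i : V) :
    (G.twistedLaplacian φ).mulVec x i =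
      ∑ d : E × Bool with G.src d = i, (x i - φ d * x (G.tgt d)) := by
  simp only [Matrix.mulVec, dotProduct, twistedLaplacian, sub_mul, Finset.sum_sub_distrib]
  congr 1
  · simp [degree]
  · simp_rw [Finset.sum_mul, Finset.sum_filter, ← Finset.sum_filter]
    rw [Finset.sum_comm' (s' := fun d => {G.tgt d}) (t' := Finset.univ.filter fun d => G.src d = i)]
    · simp
    · intro v d
      simp
      tauto

theorem twistedLaplacian_one_mulVec_one [Fintype V] :
    (G.twistedLaplacian (1 : E × Bool → R)).mulVec 1 = 0 := by
  ext i
  simp [twistedLaplacian_mulVec]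

theorem one_vecMul_twistedLaplacian_one [Fintype V] :
    Matrix.vecMul 1 (G.twistedLaplacian (1 : E × Bool → R)) = 0 := by
  rw [← Matrix.mulVec_transpose, transpose_twistedLaplacian]
  exact G.twistedLaplacian_one_mulVec_one

theorem det_twistedLaplacian_one [Fintype V] [Nonempty V] [IsDomain R] :
    (G.twistedLaplacian (1 : E × Bool → R)).det = 0 :=
  Matrix.exists_mulVec_eq_zero_iff.1 ⟨1, one_ne_zero, G.twistedLaplacian_one_mulVec_one⟩

theorem rootedIncidence_mul_transpose (j : V) :
    G.rootedIncidence j * (G.rootedIncidence j).transpose =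
      G.twistedLaplacian 1 + Matrix.vecMulVec (Pi.single j 1) (Pi.single j 1) := by
  ext v w
  rw [Matrix.mul_apply, Fintype.sum_option, add_comm, Matrix.add_apply]
  congr 1
  · simp only [twistedLaplacian, degree, Matrix.transpose_apply, rootedIncidence, Option.elim,
      Finset.card_filter, Finset.sum_filter, Fintype.sum_prod_type, Fintype.sum_bool,
      Pi.sub_apply, Pi.single_apply, Nat.cast_sum, Pi.one_apply, Nat.cast_add, Nat.cast_ite,
      Nat.cast_one, Nat.cast_zero]
    simp only [src, tgt, if_true, Bool.false_eq_true, if_false]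
    by_cases h : v = w
    · subst h
      rw [if_pos rfl, ← Finset.sum_sub_distrib]
      refine Finset.sum_congr rfl fun e _ => ?_
      by_cases h₁ : G.head e = v <;> by_cases h₂ : G.tail e = v <;>
        simp [h₁, h₂, eq_comm (a := v)]
    · rw [if_neg h, zero_sub, ← Finset.sum_neg_distrib]
      refine Finset.sum_congr rfl fun e _ => ?_
      have h' : ∀ x, ¬ (v = x ∧ w = x) := fun x hx => h (hx.1.trans hx.2.symm)
      have h₁ := h' (G.head e)
      have h₂ := h' (G.tail e)
      simp only [eq_comm (b := v), eq_comm (b := w)]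
      split_ifs <;> first | (exfalso; tauto) | norm_num

/-- Only the sets of columns that consist of the root and a spanning tree are independent. -/
theorem exists_equiv_of_det_rootedIncidence_ne_zero [Fintype V] (j : V) {f : V → Option E}
    (h : ((G.rootedIncidence j).submatrix id f).det ≠ 0) :
    (G.spanningSubgraph {e | some e ∈ Set.range f}).IsTree ∧
      ∃ e : V ≃ Option {e | some e ∈ Set.range f}, f = Option.map (↑) ∘ e := by
  classical
  have hinj : Function.Injective f := by
    intro a b hab
    by_contra hne
    exact h (Matrix.det_zero_of_column_eq hne fun v => by simp [hab])
  have hnone : none ∈ Set.range f := by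
    by_contra hn
    refine h (Matrix.exists_vecMul_eq_zero_iff.1 ⟨1, ?_, ?_⟩)
    · intro h0
      simpa using congrFun h0 j
    · ext v
      have hv : Matrix.vecMul 1 (G.rootedIncidence j) (f v) = 0 := by
        cases hf : f v with
        | none => exact absurd ⟨v, hf⟩ hn
        | some e => simp [vecMul_rootedIncidence_some]
      exact hv
  obtain ⟨e, he⟩ := hinj.exists_equiv_of_range_eq
    (Option.map_injective (Subtype.val_injective (p := fun e => some e ∈ Set.range f))) (by
      ext o
      cases o with
      | none => exact iff_of_true hnone ⟨none, rfl⟩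
      | some a => exact (Option.some_mem_range_map_val {e | some e ∈ Set.range f} a).symm)
  refine ⟨?_, e, he⟩
  rw [← det_rootedIncidence_ne_zero_iff _ j e, ← rootedIncidence_submatrix,
    Matrix.submatrix_submatrix]
  rwa [he] at h

/-- The matrix-tree theorem over `ℤ`: by the Cauchy–Binet formula a cofactor of the Laplacian counts the
maps onto the sets of columns that consist of the root and a spanning tree. -/
theorem adjugate_twistedLaplacian_one_int [Fintype V] (j : V) :
    (G.twistedLaplacian (1 : E × Bool → ℤ)).adjugate j j = G.numSpanningTrees := by
  classical
  set U := G.rootedIncidence j with hU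
  have hsq : ∀ f : V → Option E, (U.submatrix id f).det * (U.transpose.submatrix f id).det =
      if (U.submatrix id f).det ≠ 0 then 1 else 0 := by
    intro f
    rw [← Matrix.transpose_submatrix, Matrix.det_transpose]
    split_ifs with h
    · obtain ⟨ht, e, he⟩ := G.exists_equiv_of_det_rootedIncidence_ne_zero j h
      have := ht.1.det_sq_eq_one j e
      rw [← rootedIncidence_submatrix, Matrix.submatrix_submatrix, Function.id_comp, ← he] at this
      rw [← sq, this]
    · push Not at h
      simp [h]
  have hcount : (Finset.univ.filter fun f : V → Option E => (U.submatrix id f).det ≠ 0).card =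
      G.numSpanningTrees * (Fintype.card V).factorial := by
    rw [numSpanningTrees, Set.ncard_eq_toFinset_card', Finset.card_eq_sum_card_fiberwise
      (f := fun f : V → Option E => {e | some e ∈ Set.range f})
      (t := Set.toFinset {S : Set E | (G.spanningSubgraph S).IsTree})]
    · rw [Finset.sum_const_nat]
      intro S hS
      have hS : (G.spanningSubgraph S).IsTree := by simpa using hS
      have e₀ : V ≃ Option S := Fintype.equivOfCardEq hS.card_eq
      rw [← Fintype.card_equiv e₀, ← Finset.card_univ]
      symm
      refine Finset.card_bij (fun (e : V ≃ Option S) _ => Option.map (↑) ∘ e) ?_ ?_ ?_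
      · intro e _
        simp only [Finset.mem_filter, Finset.mem_univ, true_and]
        refine ⟨?_, ?_⟩
        · rw [← (G.spanningSubgraph S).det_rootedIncidence_ne_zero_iff j e,
            ← rootedIncidence_submatrix, Matrix.submatrix_submatrix] at hS
          exact hS
        · ext a
          rw [EquivLike.range_comp]
          exact Option.some_mem_range_map_val S a
      · intro e _ e' _ h
        ext1 v
        exact Option.map_injective Subtype.val_injective (congrFun h v)
      · intro f hf
        simp only [Finset.mem_filter, Finset.mem_univ, true_and] at hf
        have hS' := hf.2
        obtain ⟨-, hf⟩ := G.exists_equiv_of_det_rootedIncidence_ne_zero j hf.1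
        rw [hS'] at hf
        obtain ⟨e, he⟩ := hf
        exact ⟨e, Finset.mem_univ _, he.symm⟩
    · intro f hf
      simp only [Finset.coe_filter, Finset.mem_univ, true_and, Set.mem_ofPred_eq] at hf
      exact Set.mem_toFinset.2 (G.exists_equiv_of_det_rootedIncidence_ne_zero j hf).1
  have hdet := Matrix.factorial_mul_det_mul U U.transpose
  simp_rw [hsq] at hdet
  have : Nonempty V := ⟨j⟩
  have hadj := (G.twistedLaplacian (1 : E × Bool → ℤ)).det_add_smul_vecMulVec_single j 1
  rw [one_smul, det_twistedLaplacian_one, zero_add, one_mul] at hadj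
  rw [Finset.sum_boole, hcount, hU, rootedIncidence_mul_transpose, hadj, Nat.cast_mul,
    mul_comm] at hdet
  exact mul_right_cancel₀ (Nat.cast_ne_zero.2 (Nat.factorial_ne_zero _)) hdet

theorem adjugate_twistedLaplacian_one [Fintype V] (j : V) :
    (G.twistedLaplacian (1 : E × Bool → R)).adjugate j j = G.numSpanningTrees := by
  have h := congrArg (Int.castRingHom R) (G.adjugate_twistedLaplacian_one_int j)
  have hmap : (Int.castRingHom R).mapMatrix (G.twistedLaplacian (1 : E × Bool → ℤ)) =
      G.twistedLaplacian (1 : E × Bool → R) := by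
    rw [RingHom.mapMatrix_apply, map_twistedLaplacian]
    congr 1
    ext d
    simp
  rw [← hmap, ← RingHom.map_adjugate]
  simpa using h

theorem det_twistedLaplacian_one_add_smul [Fintype V] [Nonempty V] (c : R) :
    (G.twistedLaplacian (1 : E × Bool → R) + c • Matrix.vecMulVec 1 1).det =
      (Fintype.card V : R) ^ 2 * (c * G.numSpanningTrees) := by
  rw [Matrix.det_add_smul_vecMulVec_one _ G.one_vecMul_twistedLaplacian_one
    G.twistedLaplacian_one_mulVec_one (Classical.arbitrary V), adjugate_twistedLaplacian_one]

end Laplacian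

end Multigraph

/-! ### Evaluation of Laurent polynomials -/

theorem laurentEval_eq_eval₂ (f : ℤ[T;T⁻¹]) (z : ℂˣ) :
    laurentEval f z = LaurentPolynomial.eval₂ (Int.castRingHom ℂ) z f := by
  induction f using LaurentPolynomial.induction_on' with
  | add p q hp hq =>
    rw [map_add, ← hp, ← hq]
    exact Finsupp.sum_add_index' (by simp) (by intros; push_cast; ring)
  | C_mul_T n a =>
    rw [LaurentPolynomial.eval₂_C_mul_T, ← LaurentPolynomial.single_eq_C_mul_T, laurentEval]
    change Finsupp.sum (Finsupp.single n a) _ = _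
    rw [Finsupp.sum_single_index (by simp)]
    simp

namespace Multigraph

/-! ### The Laplacian of a cyclic covering -/

section Cover

open scoped Kronecker

variable {V E : Type*} [Fintype V] [DecidableEq V] [Fintype E] (H : Multigraph V E) (α : E → ℤ)

theorem laurentEval_voltagePolynomial (z : ℂˣ) :
    laurentEval (H.voltagePolynomial α) z =
      (H.twistedLaplacian fun d => (z : ℂ) ^ voltage α d).det := by
  have hmat : H.voltageMatrix α = H.twistedLaplacian fun d => LaurentPolynomial.T (voltage α d) :=
    rfl
  rw [laurentEval_eq_eval₂, voltagePolynomial, RingHom.map_det, RingHom.mapMatrix_apply, hmat,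
    map_twistedLaplacian]
  congr 2
  ext d
  simp [LaurentPolynomial.eval₂_T]

variable (n : ℕ) [NeZero n]

/-- Over each oriented edge that starts at `v`, exactly one oriented edge of the covering starts
at `(v, l)`. -/
theorem cyclicCover_laplacian_mulVec (x : V × ZMod n → ℂ) (v : V) (l : ZMod n) :
    ((H.cyclicCover α n).twistedLaplacian 1).mulVec x (v, l) =
      ∑ d : E × Bool with H.src d = v, (x (v, l) - x (H.tgt d, l + (voltage α d : ZMod n))) := by
  rw [twistedLaplacian_mulVec]
  refine Finset.sum_bij' (fun d _ => (d.1.1, d.2))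
    (fun d _ => ((d.1, if d.2 then l else l - (α d.1 : ZMod n)), d.2)) ?_ ?_ ?_ ?_ ?_
  · rintro ⟨⟨e, k⟩, b⟩ h
    rw [Finset.mem_filter_univ] at h ⊢
    cases b <;> exact congrArg Prod.fst h
  · rintro ⟨e, b⟩ h
    rw [Finset.mem_filter_univ] at h ⊢
    cases b <;> simpa [src, cyclicCover] using h
  · rintro ⟨⟨e, k⟩, b⟩ h
    rw [Finset.mem_filter_univ] at h
    cases b <;> simp [src, cyclicCover] at h ⊢ <;> simp [← h.2]
  · rintro ⟨e, b⟩ h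
    rfl
  · rintro ⟨⟨e, k⟩, b⟩ h
    rw [Finset.mem_filter_univ] at h
    cases b <;> simp [src, tgt, cyclicCover, voltage] at h ⊢ <;> simp [← h.2]

/-- The matrix of the discrete Fourier transform on `ZMod n`. -/
noncomputable def fourierMatrix : Matrix (ZMod n) (ZMod n) ℂ := fun l m =>
  ZMod.stdAddChar (l * m)

theorem sum_stdAddChar_mul (m : ZMod n) :
    ∑ l : ZMod n, ZMod.stdAddChar (l * m) = if m = 0 then (n : ℂ) else 0 := by
  have := AddChar.sum_mulShift m (ZMod.isPrimitive_stdAddChar n)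
  simpa using this

theorem det_fourierMatrix_ne_zero : (fourierMatrix n).det ≠ 0 := by
  have hmul : fourierMatrix n * (Matrix.of fun m l => ZMod.stdAddChar (-(l * m))) =
      (n : ℂ) • (1 : Matrix (ZMod n) (ZMod n) ℂ) := by
    ext l l'
    have h : ∀ m, fourierMatrix n l m * ZMod.stdAddChar (-(l' * m)) =
        ZMod.stdAddChar (m * (l - l')) := by
      intro m
      rw [fourierMatrix, ← AddChar.map_add_eq_mul]
      congr 1
      ring
    rw [Matrix.mul_apply]
    simp only [Matrix.of_apply, h, sum_stdAddChar_mul, sub_eq_zero, Matrix.smul_apply,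
      Matrix.one_apply, smul_eq_mul, mul_ite, mul_one, mul_zero]
  intro h0
  have := congrArg Matrix.det hmul
  rw [Matrix.det_mul, h0, zero_mul, Matrix.det_smul, Matrix.det_one, mul_one] at this
  exact pow_ne_zero _ (Nat.cast_ne_zero.2 (NeZero.ne n)) this.symm

theorem one_kronecker_mul_blockDiagonal (F : Matrix (ZMod n) (ZMod n) ℂ)
    (D : ZMod n → Matrix V V ℂ) (v w : V) (l m : ZMod n) :
    (((1 : Matrix V V ℂ) ⊗ₖ F) * Matrix.blockDiagonal D) (v, l) (w, m) = F l m * D m v w := by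
  rw [Matrix.mul_apply, Fintype.sum_prod_type, Finset.sum_eq_single v, Finset.sum_eq_single m]
  · simp [Matrix.blockDiagonal_apply]
  · intro b _ hb
    simp [Matrix.blockDiagonal_apply, hb]
  · simp
  · intro b _ hb
    simp [Ne.symm hb]
  · simp

/-- The Fourier transform along the fibres block-diagonalizes the Laplacian of the covering; the
all-ones matrix only affects the block of the trivial character. -/
theorem cyclicCover_laplacian_mul_fourier :
    ((H.cyclicCover α n).twistedLaplacian (1 : (E × ZMod n) × Bool → ℂ) +
        (1 : ℂ) • Matrix.vecMulVec 1 1) * ((1 : Matrix V V ℂ) ⊗ₖ fourierMatrix n) =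
      ((1 : Matrix V V ℂ) ⊗ₖ fourierMatrix n) * Matrix.blockDiagonal fun m : ZMod n =>
        H.twistedLaplacian (fun d => ZMod.stdAddChar m ^ voltage α d) +
          (if m = 0 then (n : ℂ) else 0) • Matrix.vecMulVec 1 1 := by
  ext ⟨v, l⟩ ⟨w, m⟩
  rw [one_kronecker_mul_blockDiagonal, add_mul, Matrix.add_apply, Matrix.add_apply, mul_add]
  congr 1
  · have h₁ := H.cyclicCover_laplacian_mulVec α n
      (fun a => ((1 : Matrix V V ℂ) ⊗ₖ fourierMatrix n) a (w, m)) v l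
    have h₂ := H.twistedLaplacian_mulVec (fun d => ZMod.stdAddChar m ^ voltage α d)
      (Pi.single w (1 : ℂ)) v
    rw [Matrix.mulVec_single_one] at h₂
    refine h₁.trans ?_
    rw [← Matrix.col_apply (H.twistedLaplacian _) w v, h₂, Finset.mul_sum]
    refine Finset.sum_congr rfl fun d _ => ?_
    have hφ : fourierMatrix n (l + (voltage α d : ZMod n)) m =
        fourierMatrix n l m * ZMod.stdAddChar m ^ voltage α d := by
      rw [fourierMatrix, fourierMatrix, ← AddChar.map_zsmul_eq_zpow, ← AddChar.map_add_eq_mul,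
        zsmul_eq_mul, add_mul]
    simp only [Matrix.kronecker_apply, hφ, Matrix.one_apply, Pi.single_apply]
    ring
  · rw [one_smul, Matrix.mul_apply]
    simp only [Matrix.vecMulVec_apply, Pi.one_apply, one_mul, Fintype.sum_prod_type,
      Matrix.kronecker_apply, Matrix.one_apply, ite_mul, zero_mul,
      Matrix.smul_apply, smul_eq_mul, mul_one]
    rw [Finset.sum_eq_single w (by intro b _ hb; simp [hb]) (by simp)]
    simp only [if_true]
    rw [show ∑ i, fourierMatrix n i m = _ from sum_stdAddChar_mul n m]
    split_ifs with h
    · simp [h, fourierMatrix]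
    · simp

/-- The spanning trees of the covering are counted by the values of the voltage polynomial at the
`n`-th roots of unity other than `1`. -/
theorem numSpanningTrees_cyclicCover [Nonempty V] :
    (n : ℂ) * (H.cyclicCover α n).numSpanningTrees =
      H.numSpanningTrees * ∏ m ∈ Finset.univ.erase (0 : ZMod n),
        laurentEval (H.voltagePolynomial α) (ZMod.stdAddChar m) := by
  have hdet := congrArg Matrix.det (H.cyclicCover_laplacian_mul_fourier α n)
  have hW : ((1 : Matrix V V ℂ) ⊗ₖ fourierMatrix n).det ≠ 0 := by
    rw [Matrix.det_kronecker]
    simpa only [Matrix.det_one, one_pow, one_mul] using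
      pow_ne_zero (Fintype.card V) (det_fourierMatrix_ne_zero n)
  rw [Matrix.det_mul, Matrix.det_mul, mul_comm] at hdet
  have hdet := mul_left_cancel₀ hW hdet
  rw [Matrix.det_blockDiagonal, det_twistedLaplacian_one_add_smul,
    ← Finset.mul_prod_erase _ _ (Finset.mem_univ (0 : ZMod n))] at hdet
  have h0 : (fun d => (ZMod.stdAddChar (0 : ZMod n) : ℂ) ^ voltage α d) =
      (1 : E × Bool → ℂ) := by
    ext d
    simp
  have hP : ∏ m ∈ Finset.univ.erase (0 : ZMod n),
      (H.twistedLaplacian (fun d => (ZMod.stdAddChar m : ℂ) ^ voltage α d) +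
        (if m = 0 then (n : ℂ) else 0) • Matrix.vecMulVec 1 1).det =
      ∏ m ∈ Finset.univ.erase (0 : ZMod n),
        laurentEval (H.voltagePolynomial α) (ZMod.stdAddChar m) := by
    refine Finset.prod_congr rfl fun m hm => ?_
    have hz : (ZMod.stdAddChar m : ℂ) ≠ 0 := by
      rw [ZMod.stdAddChar_apply]
      exact Circle.coe_ne_zero _
    rw [if_neg (Finset.ne_of_mem_erase hm), zero_smul, add_zero]
    exact (H.laurentEval_voltagePolynomial α (Units.mk0 _ hz)).symm
  rw [hP, h0, if_pos rfl, det_twistedLaplacian_one_add_smul, Fintype.card_prod, ZMod.card] at hdet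
  have hn : (n : ℂ) ≠ 0 := Nat.cast_ne_zero.2 (NeZero.ne n)
  have hV : (Fintype.card V : ℂ) ≠ 0 := Nat.cast_ne_zero.2 Fintype.card_ne_zero
  refine mul_left_cancel₀ (mul_ne_zero hn (pow_ne_zero 2 hV)) ?_
  push_cast at hdet
  linear_combination hdet

end Cover

/-! ### The order of vanishing of the voltage polynomial at one -/

section Vanishing

open Filter Topology Asymptotics ComplexConjugate

variable {V E : Type*}

/-- If the voltages are the differences of a potential, they vanish on all closed walks. -/
theorem closure_cycleVoltages_eq_bot {G : Multigraph V E} {α : E → ℤ} (y : V → ℂ)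
    (h : ∀ e, (α e : ℂ) = y (G.head e) - y (G.tail e)) :
    AddSubgroup.closure (G.cycleVoltages α) = ⊥ := by
  rw [AddSubgroup.closure_eq_bot_iff]
  rintro k ⟨p, ⟨-, ⟨v, hv⟩, -⟩, rfl⟩
  have hsum := hv.sum_sub y
  have hvolt : ∀ d, y (G.tgt d) - y (G.src d) = ((voltage α d : ℤ) : ℂ) := by
    rintro ⟨e, b⟩
    cases b <;> simp [src, tgt, voltage, h]
  simp only [hvolt, sub_self] at hsum
  have : ((walkVoltage α p : ℤ) : ℂ) = 0 := by
    rw [← hsum, walkVoltage, Int.cast_list_sum, List.map_map]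
    rfl
  exact Int.cast_eq_zero.1 this

variable [Fintype V] [DecidableEq V] [Fintype E]

/-- The Gram matrix `U * Uᵀ` of the incidence matrix is nonsingular for a connected graph. -/
theorem Connected.numSpanningTrees_ne_zero {G : Multigraph V E} (h : G.Connected) :
    G.numSpanningTrees ≠ 0 := by
  obtain ⟨j⟩ := h.1
  have : Nonempty V := h.1
  intro h0
  have hadj := (G.twistedLaplacian (1 : E × Bool → ℤ)).det_add_smul_vecMulVec_single j 1
  rw [one_smul, det_twistedLaplacian_one, adjugate_twistedLaplacian_one, h0,
    ← rootedIncidence_mul_transpose, Nat.cast_zero, mul_zero, add_zero] at hadj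
  obtain ⟨y, hy, hUy⟩ := Matrix.exists_mulVec_eq_zero_iff.2 hadj
  have h₁ : Matrix.vecMul y (G.rootedIncidence j) = 0 := by
    rw [← dotProduct_self_eq_zero]
    have h₂ := congrArg (fun w => dotProduct y w) hUy
    rw [← Matrix.mulVec_mulVec, Matrix.dotProduct_mulVec, Matrix.mulVec_transpose] at h₂
    simpa using h₂
  obtain ⟨c, hc⟩ := h.rootedIncidence_surjective j y
  rw [Matrix.mulVecLin_apply] at hc
  refine hy (dotProduct_self_eq_zero.1 ?_)
  nth_rewrite 2 [← hc]
  rw [Matrix.dotProduct_mulVec, h₁, zero_dotProduct]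

/-- The Hermitian form of a Laplacian with unitary weights is a sum of squares over the edges. -/
theorem star_dotProduct_twistedLaplacian (G : Multigraph V E) {φ : E × Bool → ℂ}
    (hφ : ∀ e, φ (e, false) = conj (φ (e, true))) (hφ' : ∀ e, ‖φ (e, true)‖ = 1) (x : V → ℂ) :
    ∑ v, conj (x v) * (G.twistedLaplacian φ).mulVec x v =
      ((∑ e, ‖x (G.tail e) - φ (e, true) * x (G.head e)‖ ^ 2 : ℝ) : ℂ) := by
  simp only [twistedLaplacian_mulVec, Finset.mul_sum, Finset.sum_filter]
  rw [Finset.sum_comm]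
  simp only [mul_ite, mul_zero, Finset.sum_ite_eq, Finset.mem_univ, if_true, Fintype.sum_prod_type,
    Fintype.sum_bool]
  rw [Complex.ofReal_sum]
  refine Finset.sum_congr rfl fun e _ => ?_
  have h₁ : φ (e, true) * conj (φ (e, true)) = 1 := by
    rw [Complex.mul_conj, Complex.normSq_eq_norm_sq, hφ']
    simp
  have h₂ := Complex.mul_conj (x (G.tail e) - φ (e, true) * x (G.head e))
  rw [Complex.normSq_eq_norm_sq] at h₂
  rw [← h₂, hφ]
  simp only [src, tgt, if_true, Bool.false_eq_true, if_false, map_sub, map_mul]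
  linear_combination (-x (G.head e) * conj (x (G.head e))) * h₁

theorem differentiable_twistedLaplacian_adjugate (G : Multigraph V E) {φ : ℝ → E × Bool → ℂ}
    (hφ : ∀ d, Differentiable ℝ fun θ => φ θ d) (v j : V) :
    Differentiable ℝ fun θ => (G.twistedLaplacian (φ θ)).adjugate v j := by
  simp only [Matrix.adjugate_apply, Matrix.det_apply]
  refine Differentiable.fun_sum fun σ _ => Differentiable.const_smul ?_ _
  refine Differentiable.fun_finsetProd fun i _ => ?_
  by_cases h : σ i = j
  · simp [Matrix.updateRow_apply, h]
  · simp only [Matrix.updateRow_apply, h, if_false, twistedLaplacian]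
    refine (differentiable_const _).sub (Differentiable.fun_sum fun d _ => hφ d)

/-- The voltage polynomial vanishes at `1` to order at most two. On the unit circle the voltage
matrix is positive semidefinite, and a column `x` of its adjugate satisfies `⟪x, M x⟫ = O(det M)`.
If the determinant vanished to higher order, all the edge terms of the Hermitian form would vanish
to first order along `x`, and the derivative of `x` would be a potential for the voltages. -/
theorem not_isLittleO_laurentEval {H : Multigraph V E} (hH : H.Connected) {α : E → ℤ}
    (hα : AddSubgroup.closure (H.cycleVoltages α) = ⊤) :
    ¬ (fun θ : ℝ => laurentEval (H.voltagePolynomial α) (Complex.exp (θ * Complex.I)))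
      =o[𝓝 0] fun θ : ℝ => θ ^ 2 := by
  intro ho
  obtain ⟨j⟩ := hH.1
  set φ : ℝ → E × Bool → ℂ := fun θ d => Complex.exp (θ * Complex.I) ^ voltage α d with hφ
  have hφe : ∀ θ d, φ θ d = Complex.exp (θ * (voltage α d * Complex.I)) := by
    intro θ d
    rw [hφ]
    simp only
    rw [← Complex.exp_int_mul]
    congr 1
    ring
  have hderiv : ∀ d θ, HasDerivAt (fun θ => φ θ d)
      (φ θ d * (voltage α d * Complex.I)) θ := by
    intro d θ
    simp only [hφe]
    have h : HasDerivAt (fun θ : ℝ => (θ : ℂ) * (voltage α d * Complex.I))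
        (voltage α d * Complex.I) θ := by
      simpa using (Complex.ofRealCLM.hasDerivAt (x := θ)).mul_const (voltage α d * Complex.I)
    exact h.cexp
  set x : ℝ → V → ℂ := fun θ v => (H.twistedLaplacian (φ θ)).adjugate v j with hx
  have hxd : ∀ v, DifferentiableAt ℝ (fun θ => x θ v) 0 := fun v =>
    H.differentiable_twistedLaplacian_adjugate (fun d θ => (hderiv d θ).differentiableAt) v j 0
  have hMx : ∀ θ v, (H.twistedLaplacian (φ θ)).mulVec (x θ) v =
      (H.twistedLaplacian (φ θ)).det * (Pi.single j 1 : V → ℂ) v := by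
    intro θ v
    have h := congrFun (congrFun (Matrix.mul_adjugate (H.twistedLaplacian (φ θ))) v) j
    rw [Matrix.smul_apply, smul_eq_mul] at h
    rw [Pi.single_apply, ← Matrix.one_apply, ← h]
    rfl
  have hdet : ∀ θ : ℝ, laurentEval (H.voltagePolynomial α) (Complex.exp (θ * Complex.I)) =
      (H.twistedLaplacian (φ θ)).det := fun θ =>
    H.laurentEval_voltagePolynomial α (Units.mk0 _ (Complex.exp_ne_zero (θ * Complex.I)))
  have henergy : ∀ θ, ((∑ e, ‖x θ (H.tail e) - φ θ (e, true) * x θ (H.head e)‖ ^ 2 : ℝ) : ℂ) =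
      conj (x θ j) * (H.twistedLaplacian (φ θ)).det := by
    intro θ
    rw [← H.star_dotProduct_twistedLaplacian]
    · simp only [hMx, Pi.single_apply]
      simp
    · intro e
      simp only [hφe, ← Complex.exp_conj]
      congr 1
      simp [voltage]
    · intro e
      rw [hφ]
      simp only
      rw [norm_zpow, Complex.norm_exp_ofReal_mul_I, one_zpow]
  have hO : (fun θ => conj (x θ j) * (H.twistedLaplacian (φ θ)).det) =o[𝓝 0]
      fun θ : ℝ => θ ^ 2 := by
    have hb : (fun θ => conj (x θ j)) =O[𝓝 0] fun _ : ℝ => (1 : ℝ) :=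
      (Complex.continuous_conj.continuousAt.comp (hxd j).continuousAt).isBigO_one ℝ
    simp only [hdet] at ho
    simpa using hb.mul_isLittleO ho
  -- Each square is at most the whole Hermitian form, which is `o(θ ^ 2)`.
  have hedge : ∀ e, (fun θ => x θ (H.tail e) - φ θ (e, true) * x θ (H.head e)) =o[𝓝 0]
      fun θ : ℝ => θ := by
    intro e
    refine IsLittleO.of_pow (n := 2) ?_ two_ne_zero
    refine IsBigO.trans_isLittleO (IsBigO.of_bound' (Eventually.of_forall fun θ => ?_)) hO
    rw [← henergy, Complex.norm_real, Pi.pow_apply, norm_pow]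
    refine le_trans ?_ (le_abs_self _)
    exact Finset.single_le_sum
      (f := fun e => ‖x θ (H.tail e) - φ θ (e, true) * x θ (H.head e)‖ ^ 2)
      (fun _ _ => sq_nonneg _) (Finset.mem_univ e)
  -- Value and derivative at `0` of an edge difference vanish; spelled out, the derivative gives `α e`.
  have hpot : ∀ e, x 0 (H.tail e) = x 0 (H.head e) ∧
      deriv (fun θ => x θ (H.tail e)) 0 - deriv (fun θ => x θ (H.head e)) 0 =
        α e * Complex.I * x 0 (H.head e) := by
    intro e
    have h0 : x 0 (H.tail e) - φ 0 (e, true) * x 0 (H.head e) = 0 := by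
      simpa using ((hedge e).bound one_pos).self_of_nhds
    have hφ0 : φ 0 (e, true) = 1 := by simp [hφe]
    have hd : HasDerivAt (fun θ => x θ (H.tail e) - φ θ (e, true) * x θ (H.head e)) 0 0 := by
      rw [hasDerivAt_iff_isLittleO]
      simpa [h0] using hedge e
    have hd' := (hxd (H.tail e)).hasDerivAt.sub
      ((hderiv (e, true) 0).mul (hxd (H.head e)).hasDerivAt)
    have := hd.unique hd'
    rw [hφ0] at h0 this
    refine ⟨by linear_combination h0, ?_⟩
    have hv : (voltage α (e, true) : ℂ) = α e := by simp [voltage]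
    rw [hv] at this
    linear_combination -this
  have hconst : ∀ v, x 0 v = x 0 j := by
    intro v
    obtain ⟨p, hp⟩ := hH.2 j v
    rw [← sub_eq_zero, ← hp.sum_sub (x 0)]
    refine List.sum_eq_zero ?_
    intro z hz
    obtain ⟨⟨e, b⟩, -, rfl⟩ := List.mem_map.1 hz
    cases b <;> simp [src, tgt, (hpot e).1]
  have hτ : x 0 j ≠ 0 := by
    have h1 : φ 0 = 1 := by
      ext d
      simp [hφe]
    rw [hx]
    simp only
    rw [h1, adjugate_twistedLaplacian_one]
    exact Nat.cast_ne_zero.2 hH.numSpanningTrees_ne_zero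
  have hbot := closure_cycleVoltages_eq_bot (G := H) (α := α)
    (fun v => -deriv (fun θ => x θ v) 0 / (Complex.I * x 0 j)) (by
      intro e
      have h := (hpot e).2
      rw [hconst] at h
      field_simp
      linear_combination -h)
  rw [hbot] at hα
  exact bot_ne_top hα

end Vanishing

end Multigraph

/-! ### Numerators of symmetric Laurent polynomials -/

section Numerator

open Polynomial

variable {f : ℤ[T;T⁻¹]}

theorem laurentLowExponent_spec (hf : f ≠ 0) :
    f.coeff (laurentLowExponent f) ≠ 0 ∧
      ∀ k, f.coeff k ≠ 0 → laurentLowExponent f ≤ k := by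
  have hset : {k : ℤ | f.coeff k ≠ 0} = (f.coeff.support : Set ℤ) := by
    ext k
    simp
  have hfin : BddBelow {k : ℤ | f.coeff k ≠ 0} := by
    rw [hset]
    exact f.coeff.support.bddBelow
  have hne : {k : ℤ | f.coeff k ≠ 0}.Nonempty := by
    by_contra h
    refine hf (LaurentPolynomial.ext fun k => ?_)
    by_contra hk
    exact h ⟨k, hk⟩
  exact ⟨Int.csInf_mem hne hfin, fun k hk => csInf_le hfin hk⟩

theorem coeff_T_mul (g : ℤ[T;T⁻¹]) (m k : ℤ) :
    (LaurentPolynomial.T m * g).coeff k = g.coeff (k - m) := by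
  have h := AddMonoidAlgebra.coeff_single_mul_add g 1 m (k - m)
  rw [one_mul, add_sub_cancel] at h
  exact h

theorem coeff_laurentNumerator (f : ℤ[T;T⁻¹]) (k : ℕ) :
    (laurentNumerator f).coeff k = f.coeff (k + laurentLowExponent f) := by
  have h := coeff_T_mul f (-laurentLowExponent f) k
  rw [sub_neg_eq_add] at h
  exact h

theorem toLaurent_laurentNumerator (hf : f ≠ 0) :
    toLaurent (laurentNumerator f) = LaurentPolynomial.T (-laurentLowExponent f) * f := by
  ext k
  rw [coeff_T_mul, sub_neg_eq_add]
  change Finsupp.mapDomain (Nat.castEmbedding : ℕ ↪ ℤ) (laurentNumerator f).toFinsupp.coeff k = _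
  rcases lt_or_ge k 0 with hk | hk
  · rw [Finsupp.mapDomain_of_notMem_range]
    · by_contra h
      have := (laurentLowExponent_spec hf).2 _ (Ne.symm h)
      omega
    · rintro ⟨i, rfl⟩
      simp at hk
      omega
  · lift k to ℕ using hk
    have := Finsupp.mapDomain_apply (Nat.castEmbedding : ℕ ↪ ℤ).injective
      (laurentNumerator f).toFinsupp.coeff k
    exact this.trans (coeff_laurentNumerator f k)

theorem laurentEval_eq_zpow_mul (hf : f ≠ 0) {z : ℂ} (hz : z ≠ 0) :
    laurentEval f z = z ^ laurentLowExponent f * aeval z (laurentNumerator f) := by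
  have h := congrArg (LaurentPolynomial.eval₂ (Int.castRingHom ℂ) (Units.mk0 z hz))
    (toLaurent_laurentNumerator hf)
  have h' := laurentEval_eq_eval₂ f (Units.mk0 z hz)
  rw [Units.val_mk0] at h'
  rw [map_mul, LaurentPolynomial.eval₂_toLaurent, LaurentPolynomial.eval₂_T, ← h'] at h
  simp only [Units.val_zpow_eq_zpow_val, Units.val_mk0] at h
  rw [aeval_def, show algebraMap ℤ ℂ = Int.castRingHom ℂ from rfl, h, ← mul_assoc,
    ← zpow_add₀ hz, add_neg_cancel, zpow_zero, one_mul]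

theorem laurentLowExponent_nonpos (hf : f ≠ 0) (hs : LaurentPolynomial.invert f = f) :
    laurentLowExponent f ≤ 0 := by
  obtain ⟨h₁, h₂⟩ := laurentLowExponent_spec hf
  have := h₂ (-laurentLowExponent f) (by
    rw [← LaurentPolynomial.invert_apply, hs]
    exact h₁)
  omega

theorem natDegree_laurentNumerator (hf : f ≠ 0) (hs : LaurentPolynomial.invert f = f) :
    (laurentNumerator f).natDegree = 2 * (-laurentLowExponent f).toNat := by
  have hm := laurentLowExponent_nonpos hf hs
  obtain ⟨h₁, h₂⟩ := laurentLowExponent_spec hf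
  refine natDegree_eq_of_le_of_coeff_ne_zero ?_ ?_
  · rw [natDegree_le_iff_coeff_eq_zero]
    intro k hk
    rw [coeff_laurentNumerator]
    by_contra h
    have := h₂ (-(k + laurentLowExponent f)) (by rwa [← LaurentPolynomial.invert_apply, hs])
    omega
  · rw [coeff_laurentNumerator, ← hs, LaurentPolynomial.invert_apply, hs]
    convert! h₁ using 2
    omega

theorem reverse_laurentNumerator (hf : f ≠ 0) (hs : LaurentPolynomial.invert f = f) :
    (laurentNumerator f).reverse = laurentNumerator f := by
  have hm := laurentLowExponent_nonpos hf hs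
  have hd := natDegree_laurentNumerator hf hs
  ext k
  rw [coeff_reverse]
  rcases le_or_gt k (laurentNumerator f).natDegree with hk | hk
  · rw [revAt_le hk, coeff_laurentNumerator, coeff_laurentNumerator, ← hs,
      LaurentPolynomial.invert_apply, hs]
    congr 1
    omega
  · rw [revAt_eq_self_of_lt hk]

/-- A palindromic polynomial that vanishes at `1` has a double zero there. -/
theorem exists_eq_sq_mul_of_reverse_eq {N : ℤ[X]} (hN : N.reverse = N) (h1 : N.eval 1 = 0) :
    ∃ R : ℤ[X], N = (X - C 1) ^ 2 * R := by
  obtain ⟨M, rfl⟩ := dvd_iff_isRoot.2 h1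
  have hrev : (X - C 1 : ℤ[X]).reverse = -(X - C 1) := by
    have hd : (X - C 1 : ℤ[X]).natDegree = 1 := natDegree_X_sub_C 1
    ext k
    rw [coeff_reverse, hd]
    rcases k with _ | _ | k
    · simp [revAt_le, Polynomial.coeff_one]
    · simp [revAt_le, Polynomial.coeff_one]
    · rw [revAt_eq_self_of_lt (by omega)]
      simp [coeff_X, Polynomial.coeff_one]
  rw [reverse_mul_of_domain, hrev, neg_mul, ← mul_neg] at hN
  have hM : M.reverse = -M := by
    have h := mul_left_cancel₀ (X_sub_C_ne_zero 1) hN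
    rw [← h, neg_neg]
    rw [h]
  have hev : M.eval 1 = 0 := by
    let _ : Invertible (1 : ℤ) := invertibleOne
    have h := eval₂_reverse_mul_pow (RingHom.id ℤ) 1 M
    rw [hM] at h
    simp only [invOf_one, one_pow, mul_one, eval₂_id, eval_neg] at h
    omega
  obtain ⟨R, rfl⟩ := dvd_iff_isRoot.2 hev
  exact ⟨R, by ring⟩

end Numerator

/-! ### Products over roots of unity -/

section RootsOfUnity

open Polynomial

variable (n : ℕ) [NeZero n]

theorem prod_X_sub_C_stdAddChar :
    ∏ m : ZMod n, (X - C (ZMod.stdAddChar m : ℂ)) = X ^ n - 1 := by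
  have hpow : ∀ m : ZMod n, (ZMod.stdAddChar m : ℂ) ^ n = 1 := by
    intro m
    rw [← AddChar.map_nsmul_eq_pow, nsmul_eq_mul, ZMod.natCast_self, zero_mul,
      AddChar.map_zero_eq_one]
  have hn : 0 < n := NeZero.pos n
  have hmonic : (∏ m : ZMod n, (X - C (ZMod.stdAddChar m : ℂ))).Monic :=
    monic_prod_of_monic _ _ fun m _ => monic_X_sub_C _
  have hdvd : ∏ m : ZMod n, (X - C (ZMod.stdAddChar m : ℂ)) ∣ X ^ n - 1 := by
    refine Finset.prod_dvd_of_coprime ?_ ?_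
    · intro a _ b _ hab
      exact isCoprime_X_sub_C_of_isUnit_sub
        (sub_ne_zero.2 fun h => hab (ZMod.injective_stdAddChar h)).isUnit
    · intro m _
      rw [dvd_iff_isRoot]
      simp [hpow]
  refine (eq_of_monic_of_dvd_of_natDegree_le hmonic (by simpa using monic_X_pow_sub_C (1 : ℂ) hn.ne')
    hdvd ?_).symm
  rw [natDegree_prod_of_monic _ _ fun m _ => monic_X_sub_C _]
  simp only [natDegree_X_sub_C, Finset.sum_const, Finset.card_univ, ZMod.card, smul_eq_mul,
    mul_one]
  exact (natDegree_X_pow_sub_C (n := n) (r := (1 : ℂ))).le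

theorem prod_sub_stdAddChar (x : ℂ) :
    ∏ m ∈ Finset.univ.erase (0 : ZMod n), (x - ZMod.stdAddChar m) =
      ∑ i ∈ Finset.range n, x ^ i := by
  have h : ∏ m ∈ Finset.univ.erase (0 : ZMod n), (X - C (ZMod.stdAddChar m : ℂ)) =
      ∑ i ∈ Finset.range n, X ^ i := by
    refine mul_left_cancel₀ (X_sub_C_ne_zero (1 : ℂ)) ?_
    have h' := prod_X_sub_C_stdAddChar n
    rw [← Finset.mul_prod_erase _ _ (Finset.mem_univ (0 : ZMod n)), AddChar.map_zero_eq_one] at h'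
    rw [h', map_one, mul_geom_sum]
  simpa [eval_prod, eval_finsetSum] using congrArg (eval x) h

theorem prod_stdAddChar_sub (x : ℂ) :
    ∏ m ∈ Finset.univ.erase (0 : ZMod n), ((ZMod.stdAddChar m : ℂ) - x) =
      (-1) ^ (n - 1) * ∑ i ∈ Finset.range n, x ^ i := by
  have hcard : (Finset.univ.erase (0 : ZMod n)).card = n - 1 := by
    rw [Finset.card_erase_of_mem (Finset.mem_univ _), Finset.card_univ, ZMod.card]
  rw [← prod_sub_stdAddChar, ← hcard, ← Finset.prod_const, ← Finset.prod_mul_distrib]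
  exact Finset.prod_congr rfl fun m _ => by ring

theorem prod_stdAddChar :
    ∏ m ∈ Finset.univ.erase (0 : ZMod n), (ZMod.stdAddChar m : ℂ) = (-1) ^ (n - 1) := by
  have h := prod_stdAddChar_sub n 0
  obtain ⟨k, rfl⟩ := Nat.exists_eq_succ_of_ne_zero (NeZero.ne n)
  simpa [Finset.sum_range_succ'] using h

/-- The product of the values of `z ^ (-s) * (z - 1) ^ 2 * R z` over the `n`-th roots of unity other
than `1`, for a polynomial `R` of even degree. -/
theorem prod_eval_stdAddChar {R : ℂ[X]} (hdeg : Even R.natDegree) (s : ℕ) :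
    R.eval 1 * ∏ m ∈ Finset.univ.erase (0 : ZMod n), ((ZMod.stdAddChar m : ℂ) ^ (-(s : ℤ)) *
        (((ZMod.stdAddChar m : ℂ) - 1) ^ 2 * R.eval (ZMod.stdAddChar m))) =
      n ^ 2 * (-1) ^ (s * (n - 1)) * R.leadingCoeff ^ n *
        (R.roots.map fun z => z ^ n - 1).prod := by
  have hsplit := IsAlgClosed.splits R
  have hcard : R.roots.card = R.natDegree := hsplit.natDegree_eq_card_roots.symm
  have heven : Even R.roots.card := hcard ▸ hdeg
  have h₁ : R.eval 1 = R.leadingCoeff * (R.roots.map fun z => z - 1).prod := by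
    rw [hsplit.eval_eq_prod_roots]
    congr 1
    have : (R.roots.map fun z => 1 - z) = R.roots.map fun z => -1 * (z - 1) := by
      refine Multiset.map_congr rfl fun z _ => by ring
    rw [this, Multiset.prod_map_mul, Multiset.map_const', Multiset.prod_replicate,
      heven.neg_one_pow, one_mul]
  have h₂ : ∏ m ∈ Finset.univ.erase (0 : ZMod n), R.eval (ZMod.stdAddChar m) =
      R.leadingCoeff ^ (n - 1) *
        (R.roots.map fun z => ∑ i ∈ Finset.range n, z ^ i).prod := by
    simp only [hsplit.eval_eq_prod_roots]
    rw [Finset.prod_mul_distrib, Finset.prod_const, Finset.card_erase_of_mem (Finset.mem_univ _),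
      Finset.card_univ, ZMod.card, ← Multiset.prod_map_prod]
    simp only [prod_stdAddChar_sub]
    rw [Multiset.prod_map_mul, Multiset.map_const', Multiset.prod_replicate, ← pow_mul,
      mul_comm (n - 1), pow_mul, heven.neg_one_pow, one_pow, one_mul]
  have h₃ : ∏ m ∈ Finset.univ.erase (0 : ZMod n), ((ZMod.stdAddChar m : ℂ) - 1) ^ 2 =
      (n : ℂ) ^ 2 := by
    rw [Finset.prod_pow, prod_stdAddChar_sub]
    simp only [one_pow, Finset.sum_const, Finset.card_range, nsmul_eq_mul, mul_one]
    rw [mul_pow, ← pow_mul, mul_comm (n - 1), pow_mul]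
    norm_num
  have h₄ : ∏ m ∈ Finset.univ.erase (0 : ZMod n), (ZMod.stdAddChar m : ℂ) ^ (-(s : ℤ)) =
      (-1) ^ (s * (n - 1)) := by
    rw [Finset.prod_zpow, prod_stdAddChar, zpow_neg, zpow_natCast, ← pow_mul, mul_comm, ← inv_pow]
    norm_num
  have h₅ : (R.roots.map fun z => z ^ n - 1).prod =
      (R.roots.map fun z => z - 1).prod *
        (R.roots.map fun z => ∑ i ∈ Finset.range n, z ^ i).prod := by
    rw [← Multiset.prod_map_mul]
    congr 1
    exact Multiset.map_congr rfl fun z _ => (mul_geom_sum z n).symm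
  have h₆ : R.leadingCoeff ^ n = R.leadingCoeff * R.leadingCoeff ^ (n - 1) :=
    (mul_pow_sub_one (NeZero.ne n) _).symm
  rw [Finset.prod_mul_distrib, Finset.prod_mul_distrib, h₂, h₃, h₄, h₅, h₆, h₁]
  ring

end RootsOfUnity

/-! ### The second derivative at a double zero -/

theorem iteratedDeriv_two_sq_mul {g : ℂ → ℂ} {a : ℂ} (hg : AnalyticAt ℂ g a) :
    iteratedDeriv 2 (fun z => (z - a) ^ 2 * g z) a = 2 * g a := by
  have h₁ : deriv (fun z => (z - a) ^ 2 * g z) =ᶠ[nhds a]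
      fun z => (z - a) * (2 * g z + (z - a) * deriv g z) := by
    filter_upwards [hg.eventually_analyticAt] with z hz
    have hsub : HasDerivAt (fun w => w - a) 1 z := (hasDerivAt_id z).sub_const a
    have h := (hsub.fun_pow 2).mul hz.differentiableAt.hasDerivAt
    refine h.deriv.trans ?_
    simp
    ring
  rw [iteratedDeriv_succ, iteratedDeriv_one, h₁.deriv_eq]
  have hsub : HasDerivAt (fun w => w - a) 1 a := (hasDerivAt_id a).sub_const a
  have h := hsub.mul ((hg.differentiableAt.hasDerivAt.const_mul 2).add
    (hsub.mul hg.deriv.differentiableAt.hasDerivAt))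
  refine h.deriv.trans ?_
  simp

namespace Multigraph

/-! ### The voltage polynomial -/

section VoltagePolynomial

open Polynomial Filter Topology Asymptotics

variable {V E : Type*} [Fintype V] [DecidableEq V] [Fintype E]

theorem invert_voltagePolynomial (H : Multigraph V E) (α : E → ℤ) :
    LaurentPolynomial.invert (H.voltagePolynomial α) = H.voltagePolynomial α := by
  have hmat : H.voltageMatrix α = H.twistedLaplacian fun d => LaurentPolynomial.T (voltage α d) :=
    rfl
  have h := RingHom.map_det
    ((LaurentPolynomial.invert (R := ℤ)).toAlgHom : ℤ[T;T⁻¹] →+* ℤ[T;T⁻¹]) (H.voltageMatrix α)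
  refine h.trans ?_
  rw [RingHom.mapMatrix_apply, hmat, map_twistedLaplacian, voltagePolynomial, hmat,
    ← Matrix.det_transpose, transpose_twistedLaplacian]
  congr 2
  ext1 d
  obtain ⟨e, b⟩ := d
  cases b <;> simp [voltage]

/-- Up to a power of `z`, the voltage polynomial is `(z - 1) ^ 2` times a polynomial that does not
vanish at `1`. -/
theorem exists_laurentNumerator_voltagePolynomial {H : Multigraph V E} (hH : H.Connected)
    {α : E → ℤ} (hα : AddSubgroup.closure (H.cycleVoltages α) = ⊤) :
    H.voltagePolynomial α ≠ 0 ∧ ∃ R : ℤ[X],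
      laurentNumerator (H.voltagePolynomial α) = (X - C 1) ^ 2 * R ∧ aeval (1 : ℂ) R ≠ 0 := by
  have hlit := not_isLittleO_laurentEval hH hα
  have hP : H.voltagePolynomial α ≠ 0 := by
    intro h0
    refine hlit ?_
    rw [h0]
    simp [laurentEval]
  have hP1 : laurentEval (H.voltagePolynomial α) 1 = 0 := by
    have : Nonempty V := hH.1
    have h := H.laurentEval_voltagePolynomial α 1
    simp only [Units.val_one, one_zpow] at h
    rw [h]
    exact H.det_twistedLaplacian_one
  have hN1 : (laurentNumerator (H.voltagePolynomial α)).eval 1 = 0 := by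
    rw [laurentEval_eq_zpow_mul hP one_ne_zero, one_zpow, one_mul] at hP1
    have h := aeval_algebraMap_apply_eq_algebraMap_eval (A := ℂ) (1 : ℤ)
      (laurentNumerator (H.voltagePolynomial α))
    rw [map_one, hP1] at h
    exact (algebraMap ℤ ℂ).injective_int (by rw [← h, map_zero])
  obtain ⟨R, hR⟩ := exists_eq_sq_mul_of_reverse_eq
    (reverse_laurentNumerator hP (H.invert_voltagePolynomial α)) hN1
  refine ⟨hP, R, hR, fun hR1 => hlit ?_⟩
  -- On the unit circle, `P = z ^ m * (z - 1) ^ 2 * R z` with `R z → 0` and `z - 1 = O(θ)`.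
  have hz : HasDerivAt (fun θ : ℝ => Complex.exp (θ * Complex.I)) Complex.I 0 := by
    have h : HasDerivAt (fun θ : ℝ => (θ : ℂ) * Complex.I) Complex.I 0 := by
      simpa using (Complex.ofRealCLM.hasDerivAt (x := 0)).mul_const Complex.I
    simpa using h.cexp
  have hsub : (fun θ : ℝ => Complex.exp (θ * Complex.I) - 1) =O[𝓝 0] fun θ : ℝ => θ := by
    simpa using hz.isBigO_sub
  have hlim : Tendsto (fun θ : ℝ => Complex.exp (θ * Complex.I)) (𝓝 0) (𝓝 1) := by
    simpa using hz.continuousAt.tendsto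
  have hRo : (fun θ : ℝ => aeval (Complex.exp (θ * Complex.I)) R) =o[𝓝 0]
      fun _ : ℝ => (1 : ℝ) := by
    rw [isLittleO_one_iff, ← hR1]
    exact (R.continuous_aeval.tendsto 1).comp hlim
  have hpow : (fun θ : ℝ => Complex.exp (θ * Complex.I) ^
      laurentLowExponent (H.voltagePolynomial α)) =O[𝓝 0] fun _ : ℝ => (1 : ℝ) :=
    (hlim.zpow₀ _ (Or.inl one_ne_zero)).isBigO_one ℝ
  have hmain := hpow.mul_isLittleO ((hsub.pow 2).mul_isLittleO hRo)
  refine (hmain.congr_left fun θ => ?_).congr_right fun θ => by ring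
  rw [laurentEval_eq_zpow_mul hP (Complex.exp_ne_zero _), hR]
  simp

end VoltagePolynomial

end Multigraph

/-! ### The number of spanning trees of a cyclic covering -/

open Polynomial in
theorem theorem1 {V E : Type*} [Fintype V] [DecidableEq V] [Fintype E]
    (H : Multigraph V E) (hH : H.Connected) (α : E → ℤ)
    (hα : AddSubgroup.closure (H.cycleVoltages α) = ⊤) :
    ∃ s : ℕ, laurentDegree (H.voltagePolynomial α) = 2 * s ∧
      iteratedDeriv 2 (laurentEval (H.voltagePolynomial α)) 1 ≠ 0 ∧
      ∀ n : ℕ, 0 < n →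
        ((H.cyclicCover α n).numSpanningTrees : ℂ) =
          2 * n * H.numSpanningTrees * (-1) ^ (s * (n - 1)) *
              (laurentLeadingCoeff (H.voltagePolynomial α) : ℂ) ^ n /
            iteratedDeriv 2 (laurentEval (H.voltagePolynomial α)) 1 *
          (((laurentRoots (H.voltagePolynomial α)).filter (· ≠ 1)).map
            fun z => z ^ n - 1).prod := by
  obtain ⟨hP, R, hN, hR1⟩ := Multigraph.exists_laurentNumerator_voltagePolynomial hH hα
  set P := H.voltagePolynomial α with hPdef
  have hs := H.invert_voltagePolynomial α
  set s := (-laurentLowExponent P).toNat with hsdef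
  have hlow : laurentLowExponent P = -(s : ℤ) := by
    have := laurentLowExponent_nonpos hP hs
    omega
  have hdeg : (laurentNumerator P).natDegree = 2 * s := natDegree_laurentNumerator hP hs
  have hR0 : R ≠ 0 := by
    rintro rfl
    simp at hR1
  set S : ℂ[X] := R.map (algebraMap ℤ ℂ) with hS
  have hS0 : S ≠ 0 := (Polynomial.map_ne_zero_iff (algebraMap ℤ ℂ).injective_int).2 hR0
  have hSev : ∀ z : ℂ, aeval z R = S.eval z := fun z => by rw [hS, eval_map_algebraMap]
  have hmon : ((X - C 1 : ℤ[X]) ^ 2).Monic := (monic_X_sub_C 1).pow 2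
  have hlead : (laurentLeadingCoeff P : ℂ) = S.leadingCoeff := by
    rw [laurentLeadingCoeff, hN, leadingCoeff_monic_mul hmon, hS,
      leadingCoeff_map_of_injective (algebraMap ℤ ℂ).injective_int]
    rfl
  have hSdeg : Even S.natDegree := by
    have h : S.natDegree = R.natDegree := natDegree_map_eq_of_injective
      (algebraMap ℤ ℂ).injective_int R
    rw [hN, hmon.natDegree_mul' hR0, (monic_X_sub_C (1 : ℤ)).natDegree_pow,
      natDegree_X_sub_C] at hdeg
    rw [h]
    exact ⟨s - 1, by omega⟩
  have hroots : (laurentRoots P).filter (· ≠ 1) = S.roots := by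
    have hmap : (laurentNumerator P).map (algebraMap ℤ ℂ) = (X - C 1) ^ 2 * S := by
      rw [hN, Polynomial.map_mul, Polynomial.map_pow]
      simp [hS]
    rw [laurentRoots, aroots_def, hmap,
      roots_mul (mul_ne_zero (pow_ne_zero 2 (X_sub_C_ne_zero 1)) hS0), roots_pow,
      roots_X_sub_C, Multiset.filter_add, Multiset.filter_eq_nil.2, zero_add,
      Multiset.filter_eq_self]
    · rintro z hz rfl
      exact hR1 ((hSev 1).trans (isRoot_of_mem_roots hz))
    · intro z hz
      simpa using Multiset.mem_of_mem_nsmul hz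
  have heval : ∀ z : ℂ, z ≠ 0 →
      laurentEval P z = z ^ (-(s : ℤ)) * ((z - 1) ^ 2 * S.eval z) := by
    intro z hz
    rw [laurentEval_eq_zpow_mul hP hz, hN, hlow, map_mul, hSev]
    simp
  have hderiv : iteratedDeriv 2 (laurentEval P) 1 = 2 * S.eval 1 := by
    have hloc : laurentEval P =ᶠ[nhds 1]
        fun z => (z - 1) ^ 2 * (z ^ (-(s : ℤ)) * S.eval z) := by
      filter_upwards [isOpen_ne.mem_nhds (one_ne_zero : (1 : ℂ) ≠ 0)] with z hz
      rw [heval z hz]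
      ring
    rw [hloc.iteratedDeriv_eq, iteratedDeriv_two_sq_mul]
    · simp
    · exact (analyticAt_id.zpow one_ne_zero).mul (AnalyticOnNhd.eval_polynomial S 1 trivial)
  rw [hSev] at hR1
  refine ⟨s, hdeg, ?_, fun n hn => ?_⟩
  · rw [hderiv]
    exact mul_ne_zero two_ne_zero hR1
  · have : NeZero n := ⟨hn.ne'⟩
    have : Nonempty V := hH.1
    have hcover := H.numSpanningTrees_cyclicCover α n
    have hprod := prod_eval_stdAddChar n hSdeg s
    rw [Finset.prod_congr rfl fun m _ => heval (ZMod.stdAddChar m) (by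
      rw [ZMod.stdAddChar_apply]
      exact Circle.coe_ne_zero _)] at hcover
    have hn0 : (n : ℂ) ≠ 0 := Nat.cast_ne_zero.2 hn.ne'
    rw [hroots, hderiv, hlead, div_mul_eq_mul_div, eq_div_iff (mul_ne_zero two_ne_zero hR1)]
    refine mul_left_cancel₀ hn0 ?_
    linear_combination (2 * S.eval 1) * hcover + 2 * (H.numSpanningTrees : ℂ) * hprod
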